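/- Fix integers $n,p\ge 1$ and put $J=\begin{bmatrix}0&I_p\\ I_p&0\end{bmatrix}$. For $p\times p$ complex matrices $H_0,\dots,H_{2n-2}$ and $1\le m\le n$ put $H(m)=\{H_{i+j-2}\}_{i,j=1}^m$, $$\Phi_1(m)=-\mathrm i\begin{bmatrix}0\\ H_0\\ \vdots\\ H_{m-2}\end{bmatrix},\quad \Phi_2(m)=\begin{bmatrix}I_p\\0\\ \vdots\\0\end{bmatrix},\quad \Pi(m)=\begin{bmatrix}\Phi_1(m)&\Phi_2(m)\end{bmatrix},\quad P_2(m)=\begin{bmatrix}0&\cdots&0&I_p\end{bmatrix}\in\mathbb C^{p\times mp}$$ (so that $\Phi_1(1)=0$ and $\Phi_2(1)=P_2(1)=I_p$). If the block Hankel matrix $H(n)$ is positive-definite, its Verblunsky-type coefficients are the $p\times 2p$ matrices $$\omega_k=P_2(k+1)H(k+1)^{-1}\Pi(k+1)\qquad(0\le k<n).$$ A sequence $\{\omega_k\}_{0\le k<n}$ is called a sequence of Verblunsky-type coefficients if it arises in this way from some positive-definite block Hankel matrix $H(n)$ with $p\times p$ blocks. Consider the canonical systems $$y_{k+1}(\lambda)=w_{k+1}(\lambda)y_k(\lambda),\quad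 w_{k+1}(\lambda)=I_{2p}+\frac{\mathrm i}{\lambda}JQ_k,\quad Q_k=\gamma_k^*\gamma_k\qquad(0\le k<n,\ \lambda\in\mathbb C\setminus\{0\}),$$ where $\gamma_k\in\mathbb C^{p\times 2p}$ satisfy $$\gamma_0\begin{bmatrix}I_p\\0\end{bmatrix}=0,\qquad \gamma_kJ\gamma_k^*=0,\quad \det(\gamma_{k-1}J\gamma_k^*)\ne0\quad(0<k<n),$$ and, in the case $n=1$, also $\det\left(\gamma_0\begin{bmatrix}0\\I_p\end{bmatrix}\right)\neq0$ (for $n\ge2$ this follows from the other conditions). Two such systems are identified when their coefficient functions $w_{k+1}$ coincide for $0\le k<n$ (equivalently, when their Hamiltonians $\{Q_k\}$ coincide). Then for every sequence of Verblunsky-type coefficients $\{\omega_k\}_{0\le k<n}$ the matrices $\omega_0\begin{bmatrix}0\\I_p\end{bmatrix}$ and $\mathrm i\,\omega_kJ\omega_{k-1}^*$ $(0<k<n)$ are invertible, and the map sending $\{\omega_k\}_{0\le k<n}$ to the system with Hamiltonian $$Q_0=\omega_0^*\left(\omega_0\begin{bmatrix}0\\I_p\end{bmatrix}\right)^{-1}\omega_0,\qquad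 Q_k=\omega_k^*\big(\mathrm i\,\omega_kJ\omega_{k-1}^*\big)^{-1}\omega_k\quad(0<k<n)$$ is a bijection from the set of sequences of Verblunsky-type coefficients onto the set of these canonical systems. -/

import Mathlib

open scoped Matrix ComplexOrder

namespace HankelCanonical

noncomputable section

/-- `p × p` complex blocks. -/
abbrev Block (p : ℕ) := Matrix (Fin p) (Fin p) ℂ

/-- `p × 2p` complex matrices; the column index is split into two groups of size `p`. -/
abbrev Wide (p : ℕ) := Matrix (Fin p) (Fin p ⊕ Fin p) ℂ

/-- `2p × 2p` complex matrices. -/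
abbrev Big (p : ℕ) := Matrix (Fin p ⊕ Fin p) (Fin p ⊕ Fin p) ℂ

/-- `J = [0 I; I 0]`. -/
def J (p : ℕ) : Big p := Matrix.fromBlocks 0 1 1 0

/-- The column `[I; 0]`. -/
def colTop (p : ℕ) : Matrix (Fin p ⊕ Fin p) (Fin p) ℂ := Matrix.fromRows 1 0

/-- The column `[0; I]`. -/
def colBot (p : ℕ) : Matrix (Fin p ⊕ Fin p) (Fin p) ℂ := Matrix.fromRows 0 1

/-- The `m × m` block Hankel matrix `H(m) = {H_{i+j}}`, with `i, j = 0, …, m-1`.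
It involves only the blocks `H_0, …, H_{2m-2}`. -/
def hankel {p : ℕ} (H : ℕ → Block p) (m : ℕ) : Matrix (Fin m × Fin p) (Fin m × Fin p) ℂ :=
  Matrix.of fun x y => H ((x.1 : ℕ) + (y.1 : ℕ)) x.2 y.2

/-- The block column `Φ₁(m) = -i [0; H_0; …; H_{m-2}]`. -/
def Phi1 {p : ℕ} (H : ℕ → Block p) (m : ℕ) : Matrix (Fin m × Fin p) (Fin p) ℂ :=
  Matrix.of fun x b => if (x.1 : ℕ) = 0 then 0 else -Complex.I * H ((x.1 : ℕ) - 1) x.2 b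

/-- The block column `Φ₂(m) = [I; 0; …; 0]`. -/
def Phi2 (p m : ℕ) : Matrix (Fin m × Fin p) (Fin p) ℂ :=
  Matrix.of fun x b => if (x.1 : ℕ) = 0 then (1 : Block p) x.2 b else 0

/-- `Π(m) = [Φ₁(m) Φ₂(m)]`. -/
def bigPi {p : ℕ} (H : ℕ → Block p) (m : ℕ) : Matrix (Fin m × Fin p) (Fin p ⊕ Fin p) ℂ :=
  Matrix.fromCols (Phi1 H m) (Phi2 p m)

/-- The block row `P₂(m) = [0 … 0 I]` with `m` blocks. -/
def lastRow (p m : ℕ) : Matrix (Fin p) (Fin m × Fin p) ℂ :=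
  Matrix.of fun a x => if (x.1 : ℕ) + 1 = m then (1 : Block p) a x.2 else 0

/-- The Verblunsky-type coefficient `ω_k = P₂(k+1) H(k+1)⁻¹ Π(k+1)` of a block Hankel matrix. -/
def omega {p : ℕ} (H : ℕ → Block p) (k : ℕ) : Wide p :=
  lastRow p (k + 1) * (hankel H (k + 1))⁻¹ * bigPi H (k + 1)

/-- The sequences `ω_0, …, ω_{n-1}` of Verblunsky-type coefficients of the positive-definite
block Hankel matrices `H(n)` with `p × p` blocks. -/
def verblunskySequences (p n : ℕ) : Set (Fin n → Wide p) :=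
  {ω | ∃ H : ℕ → Block p, (hankel H n).PosDef ∧ ∀ k : Fin n, ω k = omega H k}

/-- The matrix inverted in the formula for the Hamiltonian:
`ω_0 [0; I]` for `k = 0` and `i ω_k J ω_{k-1}^*` for `0 < k < n`. -/
def pivot {p n : ℕ} (ω : Fin n → Wide p) (k : Fin n) : Block p :=
  if (k : ℕ) = 0 then ω k * colBot p
  else Complex.I • (ω k * J p * (ω ⟨(k : ℕ) - 1, lt_of_le_of_lt (Nat.sub_le _ _) k.2⟩)ᴴ)

/-- `Q_0 = ω_0^* (ω_0 [0; I])⁻¹ ω_0` and `Q_k = ω_k^* (i ω_k J ω_{k-1}^*)⁻¹ ω_k`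
for `0 < k < n`. -/
def hamiltonian {p n : ℕ} (ω : Fin n → Wide p) (k : Fin n) : Big p :=
  (ω k)ᴴ * (pivot ω k)⁻¹ * ω k

/-- The system `y_{k+1}(z) = w_{k+1}(z) y_k(z)`, `0 ≤ k < n`, with
`w_{k+1}(z) = I + (i/z) J Q_k`, given by its coefficient functions `w_{k+1}` on `z ≠ 0`. -/
def system {p n : ℕ} (Q : Fin n → Big p) : Fin n → {z : ℂ // z ≠ 0} → Big p :=
  fun k z => 1 + (Complex.I / (z : ℂ)) • (J p * Q k)

/-- The conditions on `γ_0, …, γ_{n-1}`: `γ_0 [I; 0] = 0`, and `γ_k J γ_k^* = 0`,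
`det (γ_{k-1} J γ_k^*) ≠ 0` for `0 < k < n`. When `n ≥ 2`, these force `γ_0 [0; I]` to be
invertible; when `n = 1`, this has to be required separately. -/
structure Admissible {p n : ℕ} (γ : Fin n → Wide p) : Prop where
  initial : ∀ h : 0 < n, γ ⟨0, h⟩ * colTop p = 0
  isotropic : ∀ k : Fin n, 0 < (k : ℕ) → γ k * J p * (γ k)ᴴ = 0
  det_ne_zero : ∀ (k : ℕ) (h : k + 1 < n),
    (γ ⟨k, Nat.lt_of_succ_lt h⟩ * J p * (γ ⟨k + 1, h⟩)ᴴ).det ≠ 0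
  initial_det_ne_zero : ∀ h : n = 1, (γ ⟨0, h ▸ Nat.one_pos⟩ * colBot p).det ≠ 0

/-- The canonical systems whose Hamiltonian has the form `Q_k = γ_k^* γ_k` with `γ`
admissible. -/
def canonicalSystems (p n : ℕ) : Set (Fin n → {z : ℂ // z ≠ 0} → Big p) :=
  {w | ∃ γ : Fin n → Wide p, Admissible γ ∧ w = system (fun k => (γ k)ᴴ * γ k)}

end

end HankelCanonical

open scoped Matrix ComplexOrder

namespace HankelCanonical

noncomputable section

open Matrix

variable {p : ℕ}

/-! Let `S` be the block shift. The Hankel structure amounts to `Π J Π* = -i (S H - H S*)`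
(`displacement`). Sandwiching this between last block rows and columns of inverses gives `ω_k J ω_k*
= 0` and `i ω_{k+1} J ω_k* = T_{k+1} > 0`, where `T_k` is the last diagonal block of `H(k+1)⁻¹`;
also `ω_0 [I; 0] = 0` and `ω_0 [0; I] = T_0`.

These relations characterise the coefficients (`mem_verblunskySequences`). Given `H(k+1)`, the free
data are a Hermitian `h = H_{2k+1}` and a Schur complement `D > 0`, and `ω_{k+1} = D⁻¹ (ν - h ω_k)`
with `ν` depending on `H(k+1)` alone. A prescribed `w` forces `D = T⁻¹`, where `T = i w J ω_k*`.
Then `ν - T⁻¹ w` is `J`-orthogonal to `ω_k`, hence equals some `h ω_k`, and isotropy of `w` makes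
`h` Hermitian (`exists_extend`).

The bijection is then algebra: `Q_0 [0; I] = ω_0*` and `i Q_k J ω_{k-1}* = ω_k*` recover `ω`
recursively, while `γ_k` and `ω_k` differ by an invertible left factor. -/

/-! ### Block selection and shift matrices -/

/-- The block row `[I 0]`, deleting the last block of a column of `m + 1` blocks. -/
def dropLast (p m : ℕ) : Matrix (Fin m × Fin p) (Fin (m + 1) × Fin p) ℂ :=
  (1 : Matrix (Fin (m + 1) × Fin p) (Fin (m + 1) × Fin p) ℂ).submatrix
    (fun x => (x.1.castSucc, x.2)) id

/-- The block column `[0; I]`, prepending a zero block to a column of `m` blocks. -/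
def shiftDown (p m : ℕ) : Matrix (Fin (m + 1) × Fin p) (Fin m × Fin p) ℂ :=
  (1 : Matrix (Fin (m + 1) × Fin p) (Fin (m + 1) × Fin p) ℂ).submatrix
    id (fun x => (x.1.succ, x.2))

theorem dropLast_mul {α : Type*} (m : ℕ) (M : Matrix (Fin (m + 1) × Fin p) α ℂ) :
    dropLast p m * M = M.submatrix (fun x => (x.1.castSucc, x.2)) id := by
  ext x y
  simp [dropLast, mul_apply, one_apply]

theorem mul_dropLast_conjTranspose {α : Type*} (m : ℕ) (M : Matrix α (Fin (m + 1) × Fin p) ℂ) :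
    M * (dropLast p m)ᴴ = M.submatrix id (fun x => (x.1.castSucc, x.2)) := by
  ext x y
  simp [dropLast, mul_apply, one_apply, apply_ite]

theorem lastRow_mul {α : Type*} (m : ℕ) (M : Matrix (Fin (m + 1) × Fin p) α ℂ) :
    lastRow p (m + 1) * M = M.submatrix (fun a => (Fin.last m, a)) id := by
  have : lastRow p (m + 1) = (1 : Matrix (Fin (m + 1) × Fin p) (Fin (m + 1) × Fin p) ℂ).submatrix
      (fun a => (Fin.last m, a)) id := by
    ext a x
    obtain ⟨i, b⟩ := x
    by_cases h : i = Fin.last m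
    · subst h; simp [lastRow, one_apply]
    · have : ¬ (i : ℕ) = m := fun h' => h (Fin.ext h')
      simp [lastRow, one_apply, this, Ne.symm h]
  ext x y
  simp [this, mul_apply, one_apply]

theorem mul_lastRow_conjTranspose {α : Type*} (m : ℕ) (M : Matrix α (Fin (m + 1) × Fin p) ℂ) :
    M * (lastRow p (m + 1))ᴴ = M.submatrix id (fun a => (Fin.last m, a)) := by
  have := congrArg conjTranspose (lastRow_mul m Mᴴ)
  simpa using this

theorem dropLast_mul_lastRow (m : ℕ) : dropLast p m * (lastRow p (m + 1))ᴴ = 0 := by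
  rw [dropLast_mul]
  ext ⟨i, a⟩ b
  have : ¬ (i : ℕ) = m := by omega
  simp [lastRow, this]

theorem lastRow_mul_dropLast (m : ℕ) : lastRow p (m + 1) * (dropLast p m)ᴴ = 0 := by
  have := congrArg conjTranspose (dropLast_mul_lastRow (p := p) m)
  simpa using this

theorem lastRow_mul_lastRow (m : ℕ) : lastRow p (m + 1) * (lastRow p (m + 1))ᴴ = 1 := by
  rw [lastRow_mul]
  ext a b
  simp [lastRow, one_apply, apply_ite, eq_comm]

theorem shiftDown_mul_lastRow (m : ℕ) :
    shiftDown p (m + 1) * (lastRow p (m + 1))ᴴ = (lastRow p (m + 2))ᴴ := by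
  rw [mul_lastRow_conjTranspose]
  ext ⟨i, a⟩ b
  by_cases h : i = Fin.last (m + 1)
  · subst h; simp [lastRow, shiftDown, one_apply, apply_ite, eq_comm]
  · have : ¬ (i : ℕ) = m + 1 := fun h' => h (Fin.ext h')
    simp [lastRow, shiftDown, one_apply, this, h]

theorem dropLast_mul_hankel_mul (H : ℕ → Block p) (m : ℕ) :
    dropLast p m * hankel H (m + 1) * (dropLast p m)ᴴ = hankel H m := by
  rw [dropLast_mul, mul_dropLast_conjTranspose]
  rfl

theorem dropLast_mul_bigPi (H : ℕ → Block p) (m : ℕ) :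
    dropLast p m * bigPi H (m + 1) = bigPi H m := by
  rw [dropLast_mul]
  ext x (y | y) <;> rfl

/-- A matrix is determined by its block columns with respect to the splitting of the last block. -/
theorem ext_dropLast_lastRow {α : Type*} {m : ℕ} {M N : Matrix α (Fin (m + 1) × Fin p) ℂ}
    (h₁ : M * (dropLast p m)ᴴ = N * (dropLast p m)ᴴ)
    (h₂ : M * (lastRow p (m + 1))ᴴ = N * (lastRow p (m + 1))ᴴ) : M = N := by
  simp only [mul_dropLast_conjTranspose, mul_lastRow_conjTranspose] at h₁ h₂
  ext x ⟨i, a⟩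
  induction i using Fin.lastCases with
  | last => exact congrFun (congrFun h₂ x) a
  | cast i => exact congrFun (congrFun h₁ x) (i, a)

/-! ### Displacement identity and the `J`-relations -/

theorem isHermitian_block {H : ℕ → Block p} {m : ℕ} (hH : (hankel H (m + 1)).IsHermitian)
    {i : ℕ} (hi : i ≤ 2 * m) : (H i).IsHermitian := by
  ext a b
  -- An index `i ≤ 2m` splits into two positions at most `m`; the block there and its mirror image
  -- are both `H_i`.
  have := hH.apply (⟨min i m, by omega⟩, a) (⟨i - min i m, by omega⟩, b)
  simp only [hankel, of_apply] at this
  rwa [show i - min i m + min i m = i by omega, show min i m + (i - min i m) = i by omega] at this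

/-- The displacement identity of block Hankel matrices. -/
theorem displacement {H : ℕ → Block p} {m : ℕ} (hH : (hankel H (m + 1)).IsHermitian) :
    bigPi H (m + 1) * J p * (bigPi H (m + 1))ᴴ =
      -Complex.I • (shiftDown p m * dropLast p m * hankel H (m + 1) -
        hankel H (m + 1) * (dropLast p m)ᴴ * (shiftDown p m)ᴴ) := by
  have h1 : bigPi H (m + 1) * J p * (bigPi H (m + 1))ᴴ =
      Phi2 p (m + 1) * (Phi1 H (m + 1))ᴴ + Phi1 H (m + 1) * (Phi2 p (m + 1))ᴴ := by
    rw [bigPi, J, fromCols_mul_fromBlocks, conjTranspose_fromCols_eq_fromRows_conjTranspose,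
      fromCols_mul_fromRows]
    simp
  rw [h1, Matrix.mul_assoc, dropLast_mul, mul_dropLast_conjTranspose]
  have hb : ∀ i ≤ 2 * m, ∀ a b, star (H i a b) = H i b a := fun i hi a b =>
    (isHermitian_block hH hi).apply b a
  ext ⟨i, a⟩ ⟨j, b⟩
  simp only [Matrix.add_apply, Matrix.smul_apply, Matrix.sub_apply, mul_apply, Phi1, Phi2,
    shiftDown, conjTranspose_apply, of_apply, submatrix_apply, one_apply, id, hankel,
    Fintype.sum_prod_type]
  -- `Φ₂` lives in block 0 only. When both indices are positive, the two shifted terms are the same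
  -- Hankel block and cancel.
  induction i using Fin.cases with
  | zero =>
    induction j using Fin.cases with
    | zero => simp [Prod.ext_iff, (Fin.succ_ne_zero _).symm]
    | succ j =>
      have := hb j (by omega) b a
      simp_all [Prod.ext_iff, apply_ite, ite_and, (Fin.succ_ne_zero _).symm]
  | succ i =>
    induction j using Fin.cases with
    | zero => simp [Prod.ext_iff, apply_ite, ite_and, (Fin.succ_ne_zero _).symm]
    | succ j =>
      simp [Prod.ext_iff, apply_ite, ite_and, add_assoc, add_comm 1]

/-- `T_k`, the last diagonal block of `H(k+1)⁻¹`. -/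
def leading (H : ℕ → Block p) (k : ℕ) : Block p :=
  lastRow p (k + 1) * (hankel H (k + 1))⁻¹ * (lastRow p (k + 1))ᴴ

theorem leading_posDef {H : ℕ → Block p} {k : ℕ} (hH : (hankel H (k + 1)).PosDef) :
    (leading H k).PosDef := by
  rw [leading, lastRow_mul, mul_lastRow_conjTranspose]
  exact hH.inv.submatrix (e := fun a : Fin p => (Fin.last k, a)) fun a b h => by simpa using h

theorem hankel_posDef_of_le {H : ℕ → Block p} {m n : ℕ} (hmn : m ≤ n)
    (hH : (hankel H n).PosDef) : (hankel H m).PosDef :=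
  hH.submatrix (e := fun x : Fin m × Fin p => (Fin.castLE hmn x.1, x.2)) fun x y h => by
    simpa [Prod.ext_iff] using h

/-- In the sandwiched displacement identity `H` cancels `H⁻¹` in each term, leaving a product of
`dropLast` with `lastRow`, which is zero. -/
theorem omega_isotropic {H : ℕ → Block p} {k : ℕ} (hH : (hankel H (k + 1)).PosDef) :
    omega H k * J p * (omega H k)ᴴ = 0 := by
  have hinv := hH.isUnit
  rw [isUnit_iff_isUnit_det] at hinv
  have hherm : (hankel H (k + 1))⁻¹ᴴ = (hankel H (k + 1))⁻¹ := hH.inv.isHermitian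
  calc omega H k * J p * (omega H k)ᴴ
      = lastRow p (k + 1) * (hankel H (k + 1))⁻¹ * (bigPi H (k + 1) * J p * (bigPi H (k + 1))ᴴ) *
        ((hankel H (k + 1))⁻¹ * (lastRow p (k + 1))ᴴ) := by
        simp only [omega, conjTranspose_mul, hherm, Matrix.mul_assoc]
    _ = -Complex.I • (lastRow p (k + 1) * (hankel H (k + 1))⁻¹ * (shiftDown p k *
          (dropLast p k * (hankel H (k + 1) * (hankel H (k + 1))⁻¹ * (lastRow p (k + 1))ᴴ))) -
        (lastRow p (k + 1) * ((hankel H (k + 1))⁻¹ * hankel H (k + 1)) * (dropLast p k)ᴴ) *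
          ((shiftDown p k)ᴴ * ((hankel H (k + 1))⁻¹ * (lastRow p (k + 1))ᴴ))) := by
        rw [displacement hH.isHermitian]
        simp only [Matrix.mul_smul, Matrix.smul_mul, Matrix.mul_sub, Matrix.sub_mul,
          Matrix.mul_assoc]
    _ = 0 := by
        simp [mul_nonsing_inv _ hinv, nonsing_inv_mul _ hinv, dropLast_mul_lastRow,
          lastRow_mul_dropLast]

/-- `Π(k+1)` truncates `Π(k+2)`, so the right factor is the last column of `H(k+1)⁻¹` padded by
zero. In the surviving term `H(k+1)` cancels and the shift moves `P₂(k+1)*` to `P₂(k+2)*`. -/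
theorem omega_mul_J_mul_omega_pred {H : ℕ → Block p} {k : ℕ}
    (hH : (hankel H (k + 2)).PosDef) :
    Complex.I • (omega H (k + 1) * J p * (omega H k)ᴴ) = leading H (k + 1) := by
  have hH' : (hankel H (k + 1)).PosDef := hankel_posDef_of_le (by omega) hH
  have hinv := hH.isUnit
  have hinv' := hH'.isUnit
  rw [isUnit_iff_isUnit_det] at hinv hinv'
  have hherm : (hankel H (k + 1))⁻¹ᴴ = (hankel H (k + 1))⁻¹ := hH'.inv.isHermitian
  calc Complex.I • (omega H (k + 1) * J p * (omega H k)ᴴ)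
      = Complex.I • (lastRow p (k + 2) * (hankel H (k + 2))⁻¹ *
        (bigPi H (k + 2) * J p * (bigPi H (k + 2))ᴴ) *
        ((dropLast p (k + 1))ᴴ * (hankel H (k + 1))⁻¹ * (lastRow p (k + 1))ᴴ)) := by
        simp only [omega, ← dropLast_mul_bigPi H (k + 1), conjTranspose_mul, hherm,
          Matrix.mul_assoc]
    _ = lastRow p (k + 2) * (hankel H (k + 2))⁻¹ * (shiftDown p (k + 1) *
          ((dropLast p (k + 1) * hankel H (k + 2) * (dropLast p (k + 1))ᴴ) *
            (hankel H (k + 1))⁻¹ * (lastRow p (k + 1))ᴴ)) -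
        (lastRow p (k + 2) * ((hankel H (k + 2))⁻¹ * hankel H (k + 2)) * (dropLast p (k + 1))ᴴ) *
          ((shiftDown p (k + 1))ᴴ *
          ((dropLast p (k + 1))ᴴ * (hankel H (k + 1))⁻¹ * (lastRow p (k + 1))ᴴ)) := by
        rw [displacement hH.isHermitian]
        simp only [Matrix.mul_smul, Matrix.smul_mul, Matrix.mul_sub, Matrix.sub_mul,
          Matrix.mul_assoc, smul_smul]
        simp
    _ = leading H (k + 1) := by
        rw [dropLast_mul_hankel_mul, mul_nonsing_inv _ hinv', nonsing_inv_mul _ hinv]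
        simp [lastRow_mul_dropLast, shiftDown_mul_lastRow, leading]

/-! ### Dependence on the blocks, and Schur complements -/

theorem hankel_congr {H H' : ℕ → Block p} {m : ℕ} (h : ∀ i, i + 2 ≤ 2 * m → H i = H' i) :
    hankel H m = hankel H' m := by
  ext ⟨i, a⟩ ⟨j, b⟩
  simp only [hankel, of_apply]
  rw [h _ (by omega)]

theorem bigPi_congr {H H' : ℕ → Block p} {m : ℕ} (h : ∀ i, i + 2 ≤ m → H i = H' i) :
    bigPi H m = bigPi H' m := by
  ext ⟨i, a⟩ (b | b)
  · simp only [bigPi, fromCols_apply_inl, Phi1, of_apply]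
    split_ifs with h0
    · rfl
    · rw [h _ (by omega)]
  · rfl

theorem omega_congr {H H' : ℕ → Block p} {k : ℕ} (h : ∀ i ≤ 2 * k, H i = H' i) :
    omega H k = omega H' k := by
  rw [omega, omega, hankel_congr (H' := H') fun i hi => h i (by omega),
    bigPi_congr (H' := H') fun i hi => h i (by omega)]

/-- The block row `[H_k … H_{2k-1}]`. -/
def bottomRow (H : ℕ → Block p) (k : ℕ) : Matrix (Fin p) (Fin k × Fin p) ℂ :=
  of fun a x => H (k + x.1) a x.2

/-- `[-b H(k)⁻¹ I] Π(k+1)` with `b = [H_k … H_{2k-1}]`: the coefficient `ω_k` of a block Hankel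
matrix whose last Schur complement is the identity. -/
def monicOmega (H : ℕ → Block p) (k : ℕ) : Wide p :=
  lastRow p (k + 1) * bigPi H (k + 1) - bottomRow H k * (hankel H k)⁻¹ * bigPi H k

theorem lastRow_mul_hankel_mul_dropLast (H : ℕ → Block p) (k : ℕ) :
    lastRow p (k + 1) * hankel H (k + 1) * (dropLast p k)ᴴ = bottomRow H k := by
  rw [lastRow_mul, mul_dropLast_conjTranspose]
  rfl

theorem lastRow_mul_hankel_mul_lastRow (H : ℕ → Block p) (k : ℕ) :
    lastRow p (k + 1) * hankel H (k + 1) * (lastRow p (k + 1))ᴴ = H (2 * k) := by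
  rw [lastRow_mul, mul_lastRow_conjTranspose, two_mul]
  rfl

theorem dropLast_mul_hankel_mul_lastRow {H : ℕ → Block p} {k : ℕ}
    (hH : ∀ i ≤ 2 * k, (H i).IsHermitian) :
    dropLast p k * hankel H (k + 1) * (lastRow p (k + 1))ᴴ = (bottomRow H k)ᴴ := by
  rw [dropLast_mul, mul_lastRow_conjTranspose]
  ext ⟨i, a⟩ b
  simpa [hankel, bottomRow, add_comm] using ((hH (k + i) (by omega)).apply a b).symm

/-- The splitting of the index set of `H(k+1)` according to the last block. -/
def splitEquiv (p k : ℕ) : Fin (k + 1) × Fin p ≃ (Fin k × Fin p) ⊕ Fin p :=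
  (Equiv.ofBijective
    (Sum.elim (fun x => (x.1.castSucc, x.2)) (fun a => (Fin.last k, a)) :
      (Fin k × Fin p) ⊕ Fin p → Fin (k + 1) × Fin p) (by
    constructor
    · rintro (⟨i, a⟩ | a) (⟨j, b⟩ | b) h <;> simp_all [Fin.ext_iff] <;> omega
    · rintro ⟨i, a⟩
      induction i using Fin.lastCases with
      | last => exact ⟨Sum.inr a, rfl⟩
      | cast i => exact ⟨Sum.inl (i, a), rfl⟩)).symm

theorem hankel_succ {H : ℕ → Block p} {k : ℕ} (hH : ∀ i ≤ 2 * k, (H i).IsHermitian) :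
    hankel H (k + 1) = (fromBlocks (hankel H k) (bottomRow H k)ᴴ (bottomRow H k)
      (H (2 * k))).submatrix (splitEquiv p k) (splitEquiv p k) := by
  rw [← lastRow_mul_hankel_mul_lastRow H k, ← dropLast_mul_hankel_mul_lastRow hH,
    ← lastRow_mul_hankel_mul_dropLast, ← dropLast_mul_hankel_mul H k]
  ext x y
  obtain ⟨x, rfl⟩ := (splitEquiv p k).symm.surjective x
  obtain ⟨y, rfl⟩ := (splitEquiv p k).symm.surjective y
  simp only [dropLast_mul, lastRow_mul, mul_dropLast_conjTranspose, mul_lastRow_conjTranspose]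
  rcases x with x | x <;> rcases y with y | y <;> simp <;> rfl

theorem hankel_succ_posDef {H : ℕ → Block p} {k : ℕ} (hH : ∀ i ≤ 2 * k, (H i).IsHermitian)
    (hk : (hankel H k).PosDef)
    (hS : (H (2 * k) - bottomRow H k * (hankel H k)⁻¹ * (bottomRow H k)ᴴ).PosDef) :
    (hankel H (k + 1)).PosDef := by
  let := hk.isUnit.invertible
  rw [hankel_succ hH]
  refine PosDef.submatrix ?_ (splitEquiv p k).injective
  -- The Schur criterion gives only semidefiniteness; the factored determinant is a unit, which
  -- upgrades it.
  have hpsd := (PosDef.fromBlocks₁₁ (bottomRow H k)ᴴ (H (2 * k)) hk).2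
    (by simpa using hS.posSemidef)
  rw [conjTranspose_conjTranspose] at hpsd
  rw [hpsd.posDef_iff_isUnit, isUnit_iff_isUnit_det, det_fromBlocks₁₁, invOf_eq_nonsing_inv]
  exact ((isUnit_iff_isUnit_det _).1 hk.isUnit).mul ((isUnit_iff_isUnit_det _).1 hS.isUnit)

/-- Block elimination: `[-b H(k)⁻¹ I] H(k+1) = D P₂(k+1)` with `b` the bottom row. -/
theorem lastRow_mul_inv_hankel {H : ℕ → Block p} {k : ℕ}
    (hH : ∀ i ≤ 2 * k, (H i).IsHermitian) (hk : (hankel H k).PosDef)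
    {D : Block p} (hD : D.PosDef)
    (hS : H (2 * k) - bottomRow H k * (hankel H k)⁻¹ * (bottomRow H k)ᴴ = D) :
    lastRow p (k + 1) * (hankel H (k + 1))⁻¹ =
      D⁻¹ * (lastRow p (k + 1) - bottomRow H k * (hankel H k)⁻¹ * dropLast p k) := by
  have hpos := hankel_succ_posDef hH hk (hS ▸ hD)
  have hu := (isUnit_iff_isUnit_det _).1 hk.isUnit
  have hu' := (isUnit_iff_isUnit_det _).1 hpos.isUnit
  have huD := (isUnit_iff_isUnit_det _).1 hD.isUnit
  have key : (lastRow p (k + 1) - bottomRow H k * (hankel H k)⁻¹ * dropLast p k) *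
      hankel H (k + 1) = D * lastRow p (k + 1) := by
    apply ext_dropLast_lastRow
    · rw [Matrix.sub_mul, Matrix.sub_mul, lastRow_mul_hankel_mul_dropLast,
        Matrix.mul_assoc (_ * _) (dropLast p k), Matrix.mul_assoc (_ * _) (_ * _),
        dropLast_mul_hankel_mul, Matrix.mul_assoc (bottomRow H k), nonsing_inv_mul _ hu,
        Matrix.mul_assoc D, lastRow_mul_dropLast]
      simp
    · rw [Matrix.sub_mul, Matrix.sub_mul, lastRow_mul_hankel_mul_lastRow,
        Matrix.mul_assoc (_ * _) (dropLast p k), Matrix.mul_assoc (_ * _) (_ * _),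
        dropLast_mul_hankel_mul_lastRow hH, hS, Matrix.mul_assoc D, lastRow_mul_lastRow,
        Matrix.mul_one]
  calc lastRow p (k + 1) * (hankel H (k + 1))⁻¹
      = D⁻¹ * (D * lastRow p (k + 1)) * (hankel H (k + 1))⁻¹ := by
        rw [← Matrix.mul_assoc, nonsing_inv_mul _ huD, Matrix.one_mul]
    _ = _ := by
        rw [← key, Matrix.mul_assoc, Matrix.mul_assoc, mul_nonsing_inv _ hu', Matrix.mul_one]

theorem omega_eq_inv_mul_monicOmega {H : ℕ → Block p} {k : ℕ}
    (hH : ∀ i ≤ 2 * k, (H i).IsHermitian) (hk : (hankel H k).PosDef)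
    {D : Block p} (hD : D.PosDef)
    (hS : H (2 * k) - bottomRow H k * (hankel H k)⁻¹ * (bottomRow H k)ᴴ = D) :
    omega H k = D⁻¹ * monicOmega H k := by
  rw [omega, lastRow_mul_inv_hankel hH hk hD hS, monicOmega, Matrix.mul_assoc, Matrix.sub_mul,
    Matrix.mul_assoc _ (dropLast p k), dropLast_mul_bigPi]

theorem leading_eq_inv {H : ℕ → Block p} {k : ℕ}
    (hH : ∀ i ≤ 2 * k, (H i).IsHermitian) (hk : (hankel H k).PosDef)
    {D : Block p} (hD : D.PosDef)
    (hS : H (2 * k) - bottomRow H k * (hankel H k)⁻¹ * (bottomRow H k)ᴴ = D) :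
    leading H k = D⁻¹ := by
  rw [leading, lastRow_mul_inv_hankel hH hk hD hS, Matrix.mul_assoc, Matrix.sub_mul,
    Matrix.mul_assoc _ (dropLast p k), dropLast_mul_lastRow, lastRow_mul_lastRow]
  simp

/-! ### One-step extension of the Hankel matrix -/

/-- Extension of a sequence of blocks past `H_{2k}` by `H_{2k+1} = h` and `H_{2k+2} = D'`, where
`D'` makes the last Schur complement of the block Hankel matrix equal to `D`. -/
def extend (H : ℕ → Block p) (k : ℕ) (h D : Block p) : ℕ → Block p :=
  let G := Function.update H (2 * k + 1) h
  Function.update G (2 * k + 2)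
    (D + bottomRow G (k + 1) * (hankel G (k + 1))⁻¹ * (bottomRow G (k + 1))ᴴ)

theorem extend_of_le (H : ℕ → Block p) (k : ℕ) (h D : Block p) {i : ℕ} (hi : i ≤ 2 * k) :
    extend H k h D i = H i := by
  simp only [extend]
  rw [Function.update_of_ne (by omega), Function.update_of_ne (by omega)]

theorem extend_odd (H : ℕ → Block p) (k : ℕ) (h D : Block p) :
    extend H k h D (2 * k + 1) = h := by
  simp only [extend]
  rw [Function.update_of_ne (by omega), Function.update_self]

theorem hankel_extend (H : ℕ → Block p) (k : ℕ) (h D : Block p) :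
    hankel (extend H k h D) (k + 1) = hankel H (k + 1) :=
  hankel_congr fun _ hi => extend_of_le H k h D (by omega)

theorem bottomRow_congr {H H' : ℕ → Block p} {k : ℕ} (h : ∀ i < 2 * k, H i = H' i) :
    bottomRow H k = bottomRow H' k := by
  ext a ⟨i, b⟩
  simp only [bottomRow, of_apply]
  rw [h _ (by omega)]

/-- The second update changes only `H_{2k+2}`, which enters neither the bottom row nor `H(k+1)`. -/
theorem schur_extend (H : ℕ → Block p) (k : ℕ) (h D : Block p) :
    extend H k h D (2 * (k + 1)) - bottomRow (extend H k h D) (k + 1) *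
      (hankel (extend H k h D) (k + 1))⁻¹ * (bottomRow (extend H k h D) (k + 1))ᴴ = D := by
  have h1 : ∀ i < 2 * (k + 1), extend H k h D i = Function.update H (2 * k + 1) h i := fun i hi =>
    Function.update_of_ne (by omega) _ _
  rw [bottomRow_congr h1, hankel_congr fun i hi => h1 i (by omega), sub_eq_iff_eq_add]
  exact Function.update_self ..

theorem bottomRow_extend (H : ℕ → Block p) (k : ℕ) (h D : Block p) :
    bottomRow (extend H k h D) (k + 1) =
      bottomRow (extend H k 0 1) (k + 1) + h * lastRow p (k + 1) := by
  ext a ⟨i, b⟩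
  by_cases hi : i = Fin.last k
  · subst hi
    have : k + 1 + k = 2 * k + 1 := by omega
    simp [bottomRow, lastRow, this, extend_odd, mul_apply, one_apply]
  · have hi' : (i : ℕ) < k := Fin.val_lt_last hi
    simp only [bottomRow, of_apply, Matrix.add_apply, mul_apply, lastRow]
    rw [extend_of_le _ _ _ _ (by omega), extend_of_le _ _ _ _ (by omega)]
    simp [hi'.ne]

/-- `h` occurs only in the last block of the bottom row, hence linearly, with coefficient `P₂
H(k+1)⁻¹ Π(k+1) = ω_k`. -/
theorem monicOmega_extend (H : ℕ → Block p) (k : ℕ) (h D : Block p) :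
    monicOmega (extend H k h D) (k + 1) = monicOmega (extend H k 0 1) (k + 1) - h * omega H k := by
  have hPi : ∀ h D, ∀ m ≤ k + 2, bigPi (extend H k h D) m = bigPi H m := fun h D m hm =>
    bigPi_congr fun i hi => extend_of_le _ _ _ _ (by omega)
  simp only [monicOmega, hPi _ _ _ le_rfl, hPi _ _ _ (Nat.le_succ _), hankel_extend]
  rw [bottomRow_extend, omega]
  simp only [Matrix.add_mul, Matrix.mul_assoc]
  abel

theorem extend_isHermitian {H : ℕ → Block p} {k : ℕ} (hk : (hankel H (k + 1)).PosDef)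
    {h D : Block p} (hh : h.IsHermitian) (hD : D.IsHermitian) :
    ∀ i ≤ 2 * (k + 1), (extend H k h D i).IsHermitian := by
  intro i hi
  rcases (by omega : i ≤ 2 * k ∨ i = 2 * k + 1 ∨ i = 2 * (k + 1)) with hi | rfl | rfl
  · rw [extend_of_le _ _ _ _ hi]
    exact isHermitian_block hk.isHermitian hi
  · rwa [extend_odd]
  · have := schur_extend H k h D
    rw [sub_eq_iff_eq_add] at this
    rw [this, hankel_extend]
    exact hD.add (isHermitian_mul_mul_conjTranspose _ hk.inv.isHermitian)

theorem J_conjTranspose : (J p)ᴴ = J p := by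
  simp [J, fromBlocks_conjTranspose]

theorem J_mul_J : J p * J p = 1 := by
  simp [J, fromBlocks_multiply]

/-- If `a J a^* = b J b^* = 0` and `i b J a^* = 1`, then the rows of `a` and `b` span
`ℂ^{2p}`; hence whatever is `J`-orthogonal to `a` is a multiple of `a`. -/
theorem eq_mul_of_mul_J_eq_zero {a b d : Wide p} (ha : a * J p * aᴴ = 0) (hb : b * J p * bᴴ = 0)
    (hab : Complex.I • (b * J p * aᴴ) = 1) (hd : d * J p * aᴴ = 0) :
    d = (-Complex.I • (d * J p * bᴴ)) * a := by
  have hab1 : b * J p * aᴴ = -Complex.I • (1 : Block p) := by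
    rw [← hab, smul_smul]; simp
  have hba1 : a * J p * bᴴ = Complex.I • (1 : Block p) := by
    have := congrArg conjTranspose hab1
    simpa [J_conjTranspose, Matrix.mul_assoc] using this
  have hW : fromRows a b * (J p * fromCols (-Complex.I • bᴴ) (Complex.I • aᴴ)) = 1 := by
    rw [← Matrix.mul_assoc, fromRows_mul, fromRows_mul_fromCols]
    simp [ha, hb, hab1, hba1, smul_smul]
  have hW' := mul_eq_one_comm.1 hW
  rw [Matrix.mul_assoc, fromCols_mul_fromRows] at hW'
  calc d = d * (J p * (-Complex.I • bᴴ * a + Complex.I • aᴴ * b)) := by rw [hW', Matrix.mul_one]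
    _ = -Complex.I • (d * J p * bᴴ) * a + Complex.I • (d * J p * aᴴ) * b := by
        simp only [Matrix.mul_add, Matrix.smul_mul, Matrix.mul_smul, Matrix.mul_assoc]
    _ = _ := by rw [hd]; simp

/-- Every admissible continuation of the Verblunsky-type coefficients is realised by an extension
of the block Hankel matrix. -/
theorem exists_extend {H : ℕ → Block p} {k : ℕ} (hk : (hankel H (k + 1)).PosDef)
    {w : Wide p} {T : Block p} (hT : T.PosDef) (hw : w * J p * wᴴ = 0)
    (hwT : Complex.I • (w * J p * (omega H k)ᴴ) = T) :
    ∃ h D : Block p, (hankel (extend H k h D) (k + 2)).PosDef ∧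
      omega (extend H k h D) (k + 1) = w := by
  have huT := (isUnit_iff_isUnit_det _).1 hT.isUnit
  -- The reference extension `h = 0`, `D = 1` has `ν` itself as coefficient, so the `J`-relations
  -- apply to `ν`.
  set ν := monicOmega (extend H k 0 1) (k + 1) with hν
  set a := omega H k with ha
  have hk0 : (hankel (extend H k 0 1) (k + 1)).PosDef := by rwa [hankel_extend]
  have hherm0 := extend_isHermitian hk (h := 0) (D := 1) isHermitian_zero isHermitian_one
  have hS0 := schur_extend H k 0 1
  have hpos0 : (hankel (extend H k 0 1) (k + 2)).PosDef :=
    hankel_succ_posDef hherm0 hk0 (by rw [hS0]; exact PosDef.one)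
  have hω0 : omega (extend H k 0 1) (k + 1) = ν := by
    rw [omega_eq_inv_mul_monicOmega hherm0 hk0 PosDef.one hS0]; simp [hν]
  have hνν : ν * J p * νᴴ = 0 := hω0 ▸ omega_isotropic hpos0
  have hνa : Complex.I • (ν * J p * aᴴ) = 1 := by
    have := omega_mul_J_mul_omega_pred hpos0
    rwa [hω0, leading_eq_inv hherm0 hk0 PosDef.one hS0, inv_one,
      omega_congr fun i hi => extend_of_le H k 0 1 hi] at this
  have haa : a * J p * aᴴ = 0 := omega_isotropic hk
  -- Since `D` must be `T⁻¹`, this is the monic coefficient to be attained.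
  set μ := T⁻¹ * w with hμ
  have hμμ : μ * J p * μᴴ = 0 := by
    rw [hμ, conjTranspose_mul, show T⁻¹ * w * J p * (wᴴ * T⁻¹ᴴ) = T⁻¹ * (w * J p * wᴴ) * T⁻¹ᴴ by
      simp only [Matrix.mul_assoc], hw]
    simp
  have hμa : Complex.I • (μ * J p * aᴴ) = 1 := by
    rw [hμ, Matrix.mul_assoc, Matrix.mul_assoc, ← Matrix.mul_smul, ← Matrix.mul_assoc w, hwT,
      nonsing_inv_mul _ huT]
  set h := -Complex.I • ((ν - μ) * J p * νᴴ) with hh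
  have hd : ν - μ = h * a := by
    refine eq_mul_of_mul_J_eq_zero haa hνν hνa ?_
    have : Complex.I • ((ν - μ) * J p * aᴴ) = 0 := by
      rw [Matrix.sub_mul, Matrix.sub_mul, smul_sub, hνa, hμa, sub_self]
    simpa using this
  have hherm : h.IsHermitian := by
    have hμν : μ = ν - h * a := by rw [← hd]; abel
    have e1 : ν * J p * aᴴ = -Complex.I • (1 : Block p) := by
      rw [← hνa, smul_smul]; simp
    have e2 : a * J p * νᴴ = Complex.I • (1 : Block p) := by
      have := congrArg conjTranspose e1
      simpa [J_conjTranspose, Matrix.mul_assoc] using this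
    -- With all pairings of `ν` and `a` known, isotropy of `μ` reduces to `i (h* - h) = 0`.
    have e3 : μ * J p * μᴴ = ν * J p * νᴴ - (ν * J p * aᴴ) * hᴴ - h * (a * J p * νᴴ) +
        h * (a * J p * aᴴ) * hᴴ := by
      rw [hμν, conjTranspose_sub, conjTranspose_mul]
      simp only [Matrix.sub_mul, Matrix.mul_sub, Matrix.mul_assoc]
      abel
    rw [hμμ, hνν, haa, e1, e2] at e3
    have e4 : Complex.I • (hᴴ - h) = 0 := by
      rw [e3]
      simp [sub_eq_add_neg]
    exact sub_eq_zero.1 ((smul_eq_zero.1 e4).resolve_left Complex.I_ne_zero)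
  have hkh : (hankel (extend H k h T⁻¹) (k + 1)).PosDef := by rwa [hankel_extend]
  have hhermh := extend_isHermitian hk hherm hT.inv.isHermitian
  have hSh := schur_extend H k h T⁻¹
  refine ⟨h, T⁻¹, hankel_succ_posDef hhermh hkh (by rw [hSh]; exact hT.inv), ?_⟩
  rw [omega_eq_inv_mul_monicOmega hhermh hkh hT.inv hSh, monicOmega_extend, ← hν, ← ha, ← hd,
    sub_sub_cancel, hμ, nonsing_inv_nonsing_inv _ huT, ← Matrix.mul_assoc, mul_nonsing_inv _ huT,
    Matrix.one_mul]

/-! ### Initial coefficient, pivots and the characterisation -/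

theorem wide_ext {a b : Wide p} (h₁ : a * colTop p = b * colTop p)
    (h₂ : a * colBot p = b * colBot p) : a = b := by
  rw [← fromCols_toCols a, ← fromCols_toCols b] at h₁ h₂ ⊢
  simp only [colTop, colBot, fromCols_mul_fromRows, Matrix.mul_one, Matrix.mul_zero, add_zero,
    zero_add] at h₁ h₂
  rw [h₁, h₂]

theorem omega_zero_mul_colTop (H : ℕ → Block p) : omega H 0 * colTop p = 0 := by
  have : Phi1 H 1 = 0 := by
    ext x b
    simp [Phi1]
  rw [omega, Matrix.mul_assoc, bigPi, colTop, fromCols_mul_fromRows, this]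
  simp

theorem omega_zero_mul_colBot (H : ℕ → Block p) : omega H 0 * colBot p = leading H 0 := by
  have : Phi2 p 1 = (lastRow p 1)ᴴ := by
    ext x b
    simp [Phi2, lastRow, one_apply, apply_ite, eq_comm]
  rw [omega, Matrix.mul_assoc, bigPi, colBot, fromCols_mul_fromRows, this]
  simp [leading]

theorem pivot_zero {n : ℕ} (ω : Fin n → Wide p) (h : 0 < n) :
    pivot ω ⟨0, h⟩ = ω ⟨0, h⟩ * colBot p := by
  simp [pivot]

theorem pivot_succ {n : ℕ} (ω : Fin n → Wide p) (k : ℕ) (h : k + 1 < n) :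
    pivot ω ⟨k + 1, h⟩ =
      Complex.I • (ω ⟨k + 1, h⟩ * J p * (ω ⟨k, Nat.lt_of_succ_lt h⟩)ᴴ) := by
  simp [pivot]

theorem pivot_eq_leading {n : ℕ} {H : ℕ → Block p} (hH : (hankel H n).PosDef)
    {ω : Fin n → Wide p} (hω : ∀ k : Fin n, ω k = omega H k) (k : Fin n) :
    pivot ω k = leading H k := by
  obtain ⟨k, hk⟩ := k
  cases k with
  | zero => rw [pivot_zero, hω, omega_zero_mul_colBot]
  | succ k =>
    rw [pivot_succ, hω, hω]
    exact omega_mul_J_mul_omega_pred (hankel_posDef_of_le hk hH)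

theorem pivot_posDef {n : ℕ} {ω : Fin n → Wide p} (hω : ω ∈ verblunskySequences p n)
    (k : Fin n) : (pivot ω k).PosDef := by
  obtain ⟨H, hH, h⟩ := hω
  rw [pivot_eq_leading hH h]
  exact leading_posDef (hankel_posDef_of_le k.2 hH)

theorem exists_hankel_one {w : Wide p} (h₁ : w * colTop p = 0) (h₂ : (w * colBot p).PosDef) :
    ∃ H : ℕ → Block p, (hankel H 1).PosDef ∧ omega H 0 = w := by
  have hu := (isUnit_iff_isUnit_det _).1 h₂.isUnit
  let H : ℕ → Block p := fun _ => (w * colBot p)⁻¹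
  have hherm : ∀ i ≤ 2 * 0, (H i).IsHermitian := fun _ _ => h₂.inv.isHermitian
  have h0 : (hankel H 0).PosDef := by
    rw [Subsingleton.elim (hankel H 0) 1]
    exact PosDef.one
  have hS : H (2 * 0) - bottomRow H 0 * (hankel H 0)⁻¹ * (bottomRow H 0)ᴴ = (w * colBot p)⁻¹ := by
    rw [Subsingleton.elim (bottomRow H 0) 0]
    simp [H]
  refine ⟨H, hankel_succ_posDef hherm h0 (hS ▸ h₂.inv), wide_ext ?_ ?_⟩
  · rw [omega_zero_mul_colTop, h₁]
  · rw [omega_zero_mul_colBot, leading_eq_inv hherm h0 h₂.inv hS, nonsing_inv_nonsing_inv _ hu]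

/-- A sequence satisfying the relations of Verblunsky-type coefficients is one. -/
theorem mem_verblunskySequences {n : ℕ} (hn : 1 ≤ n) {ω : Fin n → Wide p}
    (h0 : ω ⟨0, hn⟩ * colTop p = 0) (hiso : ∀ k : Fin n, 0 < (k : ℕ) → ω k * J p * (ω k)ᴴ = 0)
    (hpiv : ∀ k, (pivot ω k).PosDef) : ω ∈ verblunskySequences p n := by
  -- Each extension keeps the blocks up to `H_{2m}`, so the coefficients already matched survive.
  have key : ∀ m, m + 1 ≤ n → ∃ H : ℕ → Block p, (hankel H (m + 1)).PosDef ∧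
      ∀ k : Fin n, (k : ℕ) ≤ m → ω k = omega H k := by
    intro m
    induction m with
    | zero =>
      intro _
      obtain ⟨H, hH, h⟩ := exists_hankel_one h0 (pivot_zero ω hn ▸ hpiv ⟨0, hn⟩)
      refine ⟨H, hH, fun k hk => ?_⟩
      obtain rfl : k = ⟨0, hn⟩ := Fin.ext (by simpa using hk)
      exact h.symm
    | succ m ih =>
      intro hm
      obtain ⟨H, hH, h⟩ := ih (by omega)
      have hT := hpiv ⟨m + 1, hm⟩
      rw [pivot_succ, h ⟨m, _⟩ le_rfl] at hT
      obtain ⟨h', D, hpos, hw⟩ := exists_extend hH hT (hiso ⟨m + 1, hm⟩ (Nat.succ_pos m)) rfl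
      refine ⟨_, hpos, fun k hk => ?_⟩
      rcases hk.lt_or_eq with hk | hk
      · rw [h k (by omega)]
        exact omega_congr fun i hi => (extend_of_le H m h' D (by omega)).symm
      · obtain rfl : k = ⟨m + 1, hm⟩ := Fin.ext hk
        exact hw.symm
  obtain ⟨m, rfl⟩ := Nat.exists_eq_add_of_le' hn
  obtain ⟨H, hH, h⟩ := key m le_rfl
  exact ⟨H, hH, fun k => h k (by omega)⟩

/-! ### Injectivity -/

theorem system_injective {n : ℕ} {Q Q' : Fin n → Big p} (h : system Q = system Q') : Q = Q' := by
  funext k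
  -- One value of the spectral parameter suffices, because `J² = 1`.
  have h1 := congrFun (congrFun h k) ⟨1, one_ne_zero⟩
  simp only [system, div_one, add_right_inj] at h1
  have h2 := smul_right_injective _ Complex.I_ne_zero h1
  have h3 := congrArg (J p * ·) h2
  simpa [← Matrix.mul_assoc, J_mul_J] using h3

theorem hamiltonian_zero_mul_colBot {n : ℕ} {ω : Fin n → Wide p}
    (hω : ω ∈ verblunskySequences p n) (h : 0 < n) :
    hamiltonian ω ⟨0, h⟩ * colBot p = (ω ⟨0, h⟩)ᴴ := by
  have hu := (isUnit_iff_isUnit_det _).1 (pivot_posDef hω ⟨0, h⟩).isUnit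
  rw [hamiltonian, Matrix.mul_assoc, ← pivot_zero, Matrix.mul_assoc, nonsing_inv_mul _ hu,
    Matrix.mul_one]

theorem hamiltonian_succ_mul {n : ℕ} {ω : Fin n → Wide p}
    (hω : ω ∈ verblunskySequences p n) (k : ℕ) (h : k + 1 < n) :
    Complex.I • (hamiltonian ω ⟨k + 1, h⟩ * J p * (ω ⟨k, Nat.lt_of_succ_lt h⟩)ᴴ) =
      (ω ⟨k + 1, h⟩)ᴴ := by
  have hu := (isUnit_iff_isUnit_det _).1 (pivot_posDef hω ⟨k + 1, h⟩).isUnit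
  rw [hamiltonian, Matrix.mul_assoc, Matrix.mul_assoc, ← Matrix.mul_assoc (ω _) (J p),
    ← Matrix.mul_smul, ← pivot_succ, Matrix.mul_assoc, nonsing_inv_mul _ hu, Matrix.mul_one]

theorem hamiltonian_injOn (p n : ℕ) :
    Set.InjOn (hamiltonian : (Fin n → Wide p) → Fin n → Big p) (verblunskySequences p n) := by
  intro ω hω ω' hω' h
  have key : ∀ k (hk : k < n), ω ⟨k, hk⟩ = ω' ⟨k, hk⟩ := by
    intro k
    induction k with
    | zero =>
      intro hk
      apply conjTranspose_injective
      rw [← hamiltonian_zero_mul_colBot hω, ← hamiltonian_zero_mul_colBot hω', h]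
    | succ k ih =>
      intro hk
      apply conjTranspose_injective
      rw [← hamiltonian_succ_mul hω, ← hamiltonian_succ_mul hω', h, ih]
  exact funext fun k => key k k.2

/-! ### Hamiltonians and admissible factorisations -/

open scoped MatrixOrder Matrix.Norms.L2Operator in
theorem exists_eq_conjTranspose_mul_self {T : Block p} (hT : T.PosDef) :
    ∃ R : Block p, R.det ≠ 0 ∧ T = Rᴴ * R := by
  obtain ⟨R, hR, h⟩ := CStarAlgebra.isStrictlyPositive_iff_eq_star_mul_self.mp
    hT.isStrictlyPositive
  exact ⟨R, ((isUnit_iff_isUnit_det _).1 hR).ne_zero, h⟩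

/-- For `n ≥ 2`, `γ_0 = γ_0 [0; I] [0 I]`, so `det (γ_0 [0; I])` divides the nonzero `det (γ_0 J
γ_1*)`. -/
theorem det_mul_colBot_ne_zero {n : ℕ} (hn : 0 < n) {γ : Fin n → Wide p} (hγ : Admissible γ) :
    (γ ⟨0, hn⟩ * colBot p).det ≠ 0 := by
  by_cases h1 : n = 1
  · exact hγ.initial_det_ne_zero h1
  · have hdet := hγ.det_ne_zero 0 (by omega)
    have e₁ : (colBot p)ᴴ * colTop p = 0 := by
      rw [colBot, colTop, conjTranspose_fromRows_eq_fromCols_conjTranspose, fromCols_mul_fromRows]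
      simp
    have e₂ : (colBot p)ᴴ * colBot p = 1 := by
      rw [colBot, conjTranspose_fromRows_eq_fromCols_conjTranspose, fromCols_mul_fromRows]
      simp
    have : γ ⟨0, hn⟩ = γ ⟨0, hn⟩ * colBot p * (colBot p)ᴴ := by
      apply wide_ext
      · rw [hγ.initial hn, Matrix.mul_assoc, e₁, Matrix.mul_zero]
      · rw [Matrix.mul_assoc _ _ (colBot p), e₂, Matrix.mul_one]
    rw [this, Matrix.mul_assoc, Matrix.mul_assoc, det_mul] at hdet
    exact left_ne_zero_of_mul hdet

/-- The Hamiltonian of Verblunsky-type coefficients comes from an admissible sequence. -/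
theorem exists_admissible {n : ℕ} {ω : Fin n → Wide p} (hω : ω ∈ verblunskySequences p n) :
    ∃ γ : Fin n → Wide p, Admissible γ ∧ hamiltonian ω = fun k => (γ k)ᴴ * γ k := by
  have hpos := pivot_posDef hω
  choose R hR hR' using fun k => exists_eq_conjTranspose_mul_self (hpos k).inv
  obtain ⟨H, hH, h⟩ := hω
  refine ⟨fun k => R k * ω k, ⟨fun h0 => ?_, fun k _ => ?_, fun k hk => ?_, fun h1 => ?_⟩, ?_⟩
  · rw [Matrix.mul_assoc, h, omega_zero_mul_colTop, Matrix.mul_zero]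
  · have := omega_isotropic (hankel_posDef_of_le k.2 hH)
    rw [← h] at this
    rw [conjTranspose_mul, show R k * ω k * J p * ((ω k)ᴴ * (R k)ᴴ) =
      R k * (ω k * J p * (ω k)ᴴ) * (R k)ᴴ by simp only [Matrix.mul_assoc], this]
    simp
  · have hp := hpos ⟨k + 1, hk⟩
    have hd := ((isUnit_iff_isUnit_det _).1 hp.isUnit).ne_zero
    -- Admissibility pairs the neighbours in the opposite order; the pivot being Hermitian, this
    -- only changes the scalar.
    have e : ω ⟨k, Nat.lt_of_succ_lt hk⟩ * J p * (ω ⟨k + 1, hk⟩)ᴴ =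
        Complex.I • pivot ω ⟨k + 1, hk⟩ := by
      rw [← hp.isHermitian.eq, pivot_succ, conjTranspose_smul, smul_smul]
      simp [J_conjTranspose, Matrix.mul_assoc]
    rw [conjTranspose_mul, Matrix.mul_assoc, Matrix.mul_assoc, ← Matrix.mul_assoc (J p),
      ← Matrix.mul_assoc (ω _), ← Matrix.mul_assoc (ω _), e, det_mul, det_mul, det_smul,
      det_conjTranspose]
    simp [hR, hd]
  · subst h1
    rw [Matrix.mul_assoc, ← pivot_zero, det_mul]
    exact mul_ne_zero (hR _) ((isUnit_iff_isUnit_det _).1 (hpos _).isUnit).ne_zero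
  · funext k
    rw [hamiltonian, hR', conjTranspose_mul]
    simp only [Matrix.mul_assoc]

/-- The left factors `c_k` for which `c_k γ_k` are Verblunsky-type coefficients. -/
def normalizer (γ : ℕ → Wide p) : ℕ → Block p
  | 0 => (γ 0 * colBot p)ᴴ
  | k + 1 => -Complex.I • (normalizer γ k * (γ k * J p * (γ (k + 1))ᴴ))

/-- Every Hamiltonian of an admissible sequence comes from Verblunsky-type coefficients. -/
theorem exists_verblunsky {n : ℕ} (hn : 1 ≤ n) {γ : Fin n → Wide p} (hγ : Admissible γ) :
    ∃ ω ∈ verblunskySequences p n, hamiltonian ω = fun k => (γ k)ᴴ * γ k := by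
  -- Padding by zero lets the recursion run over `ℕ`; only indices below `n` matter.
  let g : ℕ → Wide p := fun k => if h : k < n then γ ⟨k, h⟩ else 0
  have hg : ∀ k (h : k < n), g k = γ ⟨k, h⟩ := fun k h => dif_pos h
  let c := normalizer g
  have hc : ∀ k < n, (c k).det ≠ 0 := by
    intro k
    induction k with
    | zero =>
      intro h
      have := det_mul_colBot_ne_zero h hγ
      simp only [c, normalizer, hg _ h, det_conjTranspose]
      exact star_ne_zero.2 this
    | succ k ih =>
      intro h
      have := hγ.det_ne_zero k h
      simp only [c, normalizer, hg _ h, hg _ (Nat.lt_of_succ_lt h), det_smul,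
        det_mul (normalizer g k)]
      exact mul_ne_zero (by simp) (mul_ne_zero (ih (by omega)) this)
  let ω : Fin n → Wide p := fun k => c k * γ k
  -- The recursion for `c` is chosen for this identity: positivity is automatic, and `c` cancels
  -- from `ω* (c c*)⁻¹ ω`.
  have hpiv : ∀ k, pivot ω k = c k * (c k)ᴴ := by
    rintro ⟨k, hk⟩
    cases k with
    | zero =>
      rw [pivot_zero]
      simp only [ω, c, normalizer, hg _ hk, conjTranspose_conjTranspose, Matrix.mul_assoc]
    | succ k =>
      rw [pivot_succ]
      have : (c (k + 1))ᴴ =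
          Complex.I • (γ ⟨k + 1, hk⟩ * J p * (γ ⟨k, Nat.lt_of_succ_lt hk⟩)ᴴ * (c k)ᴴ) := by
        simp [c, normalizer, hg _ hk, hg _ (Nat.lt_of_succ_lt hk), J_conjTranspose,
          Matrix.mul_assoc]
      rw [this]
      simp only [ω, conjTranspose_mul, Matrix.mul_assoc, Matrix.mul_smul]
  have hpos : ∀ k, (pivot ω k).PosDef := fun k => by
    rw [hpiv, (posSemidef_self_mul_conjTranspose (c k)).posDef_iff_isUnit, isUnit_iff_isUnit_det,
      det_mul, det_conjTranspose]
    exact (mul_ne_zero (hc k k.2) (star_ne_zero.2 (hc k k.2))).isUnit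
  refine ⟨ω, mem_verblunskySequences hn ?_ (fun k hk => ?_) hpos, ?_⟩
  · rw [Matrix.mul_assoc, hγ.initial, Matrix.mul_zero]
  · rw [show ω k * J p * (ω k)ᴴ = c k * (γ k * J p * (γ k)ᴴ) * (c k)ᴴ by
      simp only [ω, conjTranspose_mul, Matrix.mul_assoc], hγ.isotropic k hk]
    simp
  · funext k
    have hu : IsUnit (c k).det := (hc k k.2).isUnit
    have hu' : IsUnit (c k)ᴴ.det := by
      rw [det_conjTranspose]
      exact (star_ne_zero.2 (hc k k.2)).isUnit
    rw [hamiltonian, hpiv, Matrix.mul_inv_rev]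
    simp only [ω, conjTranspose_mul]
    rw [show (γ k)ᴴ * (c k)ᴴ * ((c k)ᴴ⁻¹ * (c k)⁻¹) * (c k * γ k) =
      (γ k)ᴴ * ((c k)ᴴ * (c k)ᴴ⁻¹) * (((c k)⁻¹ * c k) * γ k) by simp only [Matrix.mul_assoc],
      mul_nonsing_inv _ hu', nonsing_inv_mul _ hu, Matrix.mul_one, Matrix.one_mul]

end

end HankelCanonical

theorem mainTheorem9 (p n : ℕ) (hp : 1 ≤ p) (hn : 1 ≤ n) :
    (∀ ω ∈ HankelCanonical.verblunskySequences p n, ∀ k : Fin n,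
      IsUnit (HankelCanonical.pivot ω k)) ∧
    Set.BijOn (fun ω => HankelCanonical.system (HankelCanonical.hamiltonian ω))
      (HankelCanonical.verblunskySequences p n) (HankelCanonical.canonicalSystems p n) := by
  refine ⟨fun ω hω k => (HankelCanonical.pivot_posDef hω k).isUnit, fun ω hω => ?_,
    fun ω hω ω' hω' h => ?_, ?_⟩
  · obtain ⟨γ, hγ, h⟩ := HankelCanonical.exists_admissible hω
    exact ⟨γ, hγ, congrArg HankelCanonical.system h⟩
  · exact HankelCanonical.hamiltonian_injOn p n hω hω' (HankelCanonical.system_injective h)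
  · rintro _ ⟨γ, hγ, rfl⟩
    obtain ⟨ω, hω, h⟩ := HankelCanonical.exists_verblunsky hn hγ
    exact ⟨ω, hω, congrArg HankelCanonical.system h⟩
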